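/- Let $\mathbb{T}=\mathbb{R}/\mathbb{Z}$ be the circle with its quotient metric and normalized Lebesgue measure $m$, and let $\widehat f(n)=\int_{\mathbb{T}} f(t)e^{-2\pi i n t}\,dm(t)$, $n\in\mathbb{Z}$. Let $X$ be one of the following spaces of sequences $a=(a_n)_{n\in\mathbb{Z}}$ of complex numbers. (a) $X=\ell^1(w)$, the sequences with $\|a\|_{X}=\sum_{n\in\mathbb{Z}}|a_n|\,w_{|n|}<\infty$, where $(w_n)_{n\ge 0}$ is a non-increasing sequence of positive numbers with $w_n\to 0$. (b) $X=\ell^\Phi$, the sequences with $\|a\|_{X}=\inf\{M>0:\sum_{n\in\mathbb{Z}}\Phi(|a_n|/M)\le 1\}<\infty$, where $\Phi$ is a Young function such that $\Phi(t)/t$ decreases to $0$ as $t\downarrow 0$. Here a Young function is a convex function $\Phi:(0,\infty)\to[0,\infty)$, not identically zero, with $\Phi(0+)=0$ (put $\Phi(0)=0$) and $\Phi(t/2)\asymp\Phi(t)$ as $t\to 0+$. Let $\mathscr{C}$ be the collection of non-empty compact subsets of $\mathbb{T}$ with the Hausdorff metric $$d_{\mathscr{C}}(E,F)=\sup_{\zeta\in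 F}\operatorname{dist}(\zeta,E)+\sup_{\xi\in E}\operatorname{dist}(\xi,F),$$ and let $\mathscr{L}_{\mathscr{C}}(X)$ be the set of all pairs $(f,E)$ with $f\in L^\infty(\mathbb{T},dm)$ and $E\in\mathscr{C}$ such that (i) $\operatorname{supp}(f\,dm)\subseteq E$; (ii) $0\le f\le 10$ $dm$-a.e. on $\mathbb{T}$; (iii) $(\widehat f(n))_{n\in\mathbb{Z}}\in X$. Then $$d_X\big((f,E),(g,K)\big)=d_{\mathscr{C}}(E,K)+\big\|(\widehat f(n)-\widehat g(n))_{n\in\mathbb{Z}}\big\|_X$$ is a metric on $\mathscr{L}_{\mathscr{C}}(X)$, the metric space $(\mathscr{L}_{\mathscr{C}}(X),d_X)$ is complete, and the set of pairs $(f,E)\in\mathscr{L}_{\mathscr{C}}(X)$ for which $E$ has empty interior is generic (residual) in it, i.e. it contains a countable intersection of dense open subsets. -/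

import Mathlib

open MeasureTheory Filter Set TopologicalSpace AddCircle
open scoped ENNReal Topology Asymptotics

/-- The weighted norm `∑_{n ∈ ℤ} |a_n| w_{|n|}` of a two-sided sequence, with value `∞` exactly
when the sequence is not in `ℓ¹(w)`. -/
noncomputable def weightedL1Norm (w : ℕ → ℝ) (a : ℤ → ℂ) : ℝ≥0∞ :=
  ∑' n : ℤ, ENNReal.ofReal (‖a n‖ * w n.natAbs)

/-- The Luxemburg norm `inf {M > 0 : ∑_{n ∈ ℤ} Φ (|a_n| / M) ≤ 1}` of a two-sided sequence, with
value `∞` exactly when no such `M` exists, that is, when the sequence is not in `ℓ^Φ`. -/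
noncomputable def orliczNorm (Φ : ℝ → ℝ) (a : ℤ → ℂ) : ℝ≥0∞ :=
  ⨅ (M : ℝ) (_ : 0 < M) (_ : ∑' n : ℤ, ENNReal.ofReal (Φ (‖a n‖ / M)) ≤ 1), ENNReal.ofReal M

/-- Young functions: convex functions `Φ ≥ 0` on `(0, ∞)`, not identically zero, with `Φ(0+) = 0`
(and extended by `Φ(0) = 0`), satisfying the `Δ₂`-condition `Φ(t/2) ≍ Φ(t)` as `t → 0`.
Values at negative arguments play no role. -/
structure IsYoungFunction (Φ : ℝ → ℝ) : Prop where
  convexOn : ConvexOn ℝ (Ioi 0) Φ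
  nonneg : ∀ t, 0 < t → 0 ≤ Φ t
  nontrivial : ∃ t, 0 < t ∧ Φ t ≠ 0
  map_zero : Φ 0 = 0
  tendsto_zero : Tendsto Φ (𝓝[>] 0) (𝓝 0)
  delta_two : (fun t => Φ (t / 2)) =Θ[𝓝[>] 0] Φ

/-- Real-valued functions in `L^∞(𝕋, dm)`, where `𝕋 = ℝ/ℤ` and `m` is the normalized Lebesgue
(Haar) measure. -/
abbrev LInfCircle : Type := Lp ℝ ∞ (haarAddCircle : Measure UnitAddCircle)

/-- The Fourier coefficients `n ↦ ∫ f(t) e^{-2πint} dm(t)`. -/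
noncomputable def fourierSeq (f : LInfCircle) (n : ℤ) : ℂ :=
  fourierCoeff (fun t : UnitAddCircle => ((f t : ℝ) : ℂ)) n

/-- The closed support of the measure `f dm`, for `f ≥ 0`. -/
noncomputable def densitySupport (f : LInfCircle) : Set UnitAddCircle :=
  ((haarAddCircle : Measure UnitAddCircle).withDensity fun t => ENNReal.ofReal (f t)).support

/-- The pairs `(f, E)` with `E ⊆ 𝕋` non-empty compact, `supp (f dm) ⊆ E`, `0 ≤ f ≤ 10` a.e., and
Fourier coefficients in `X`, where `X` is the space of sequences with finite norm `normX`. -/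
structure SupportPair (normX : (ℤ → ℂ) → ℝ≥0∞) where
  f : LInfCircle
  E : NonemptyCompacts UnitAddCircle
  support_subset : densitySupport f ⊆ (E : Set UnitAddCircle)
  bounds : ∀ᵐ t ∂(haarAddCircle : Measure UnitAddCircle), 0 ≤ f t ∧ f t ≤ 10
  mem_X : normX (fourierSeq f) < ∞

/-- The Hausdorff distance
`sup_{ζ ∈ F} dist(ζ, E) + sup_{ξ ∈ E} dist(ξ, F)` (with a sum, rather than a maximum). -/
noncomputable def hausdorffSumDist (E F : NonemptyCompacts UnitAddCircle) : ℝ≥0∞ :=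
  (⨆ ζ ∈ (F : Set UnitAddCircle), Metric.infEDist ζ (E : Set UnitAddCircle)) +
    ⨆ ξ ∈ (E : Set UnitAddCircle), Metric.infEDist ξ (F : Set UnitAddCircle)

/-- `d_X((f,E),(g,K)) = d(E,K) + ‖f - g‖_X`. -/
noncomputable def pairDist (normX : (ℤ → ℂ) → ℝ≥0∞) (p q : SupportPair normX) : ℝ≥0∞ :=
  hausdorffSumDist p.E q.E + normX (fourierSeq (p.f - q.f))

/-!
Both families of norms satisfy the conditions of `IsAdmissibleNorm`
(`isAdmissibleNorm_weightedL1Norm`, `isAdmissibleNorm_orliczNorm`), and the rest of the argument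
uses only these: a solid norm with the Fatou property and dominated convergence, for which
sequences that are bounded in `ℓ¹` and uniformly small are small.

Completeness (`SupportPair.completeSpace`). The sets of a Cauchy sequence of pairs converge in the
Hausdorff metric, and the densities, being bounded by `10`, converge weakly in `L²` along an
ultrafilter (`exists_weak_limit`). Weak convergence preserves the bounds and the support condition
and implies convergence of each Fourier coefficient; the Fatou property upgrades this to convergence
in `X`.

Genericity (`SupportPair.empty_interior_mem_residual`). For every point `x` the pairs with `x ∉ E`
form an open dense set, and a closed set that misses a countable dense set of points has empty
interior. For density (`exists_pairDist_lt_notMem`), let `J` be the arc of radius `r` about `x ∈ E`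
and let `k` be the normalized indicator of an arc of length `r` centred at `0`. Replace `f` by
`g = (f 1_{Jᶜ}) * k`, and `E` by its `r / 2`-neighbourhood minus the arc of radius `r / 2` about
`x`. Then `f - g` has Fourier coefficients `(1 - k̂) f̂ + (f 1_J)^ k̂`. The first term tends to `0` in
`X` by dominated convergence. The second is uniformly `O(r)`, while by Parseval's identity and the
Cauchy–Schwarz inequality its `ℓ¹` norm is at most `‖f 1_J‖₂ ‖k‖₂ = O(r^{1/2} r^{-1/2}) = O(1)`, so
it tends to `0` in `X` as well (`tendsto_norm_indicator_mul_arcKernel`).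
-/

/-! ### Admissible norms; weighted `ℓ¹` norms -/

/-- The properties of the norm of the sequence space `X` on which the argument rests; the norm is
`∞` off `X`. -/
structure IsAdmissibleNorm (N : (ℤ → ℂ) → ℝ≥0∞) : Prop where
  map_zero : N 0 = 0
  add_le : ∀ a b : ℤ → ℂ, N (a + b) ≤ N a + N b
  mono : ∀ a b : ℤ → ℂ, (∀ n, ‖a n‖ ≤ ‖b n‖) → N a ≤ N b
  eq_zero : ∀ a : ℤ → ℂ, N a = 0 → a = 0
  /-- The Fatou property: closed balls of `X` are closed under pointwise limits. -/
  fatou : ∀ {ι : Type} (l : Filter ι) [NeBot l] (u : ι → ℤ → ℂ) (a : ℤ → ℂ) (c : ℝ≥0∞),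
    (∀ n, Tendsto (fun k => u k n) l (𝓝 (a n))) → (∀ᶠ k in l, N (u k) ≤ c) → N a ≤ c
  /-- Dominated convergence, for a dominating sequence in `X` that tends to `0` at infinity. -/
  dominated : ∀ {ι : Type} (l : Filter ι) (u : ι → ℤ → ℂ) (b : ℤ → ℂ), N b < ∞ →
    Tendsto b cofinite (𝓝 0) → (∀ᶠ k in l, ∀ n, ‖u k n‖ ≤ ‖b n‖) →
    (∀ n, Tendsto (fun k => u k n) l (𝓝 0)) → Tendsto (fun k => N (u k)) l (𝓝 0)
  /-- A family that is bounded in `ℓ¹` and tends to `0` uniformly tends to `0` in `X`. This is where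
  `w n → 0`, respectively `Φ t / t → 0`, is used. -/
  small : ∀ {ι : Type} (l : Filter ι) (u : ι → ℤ → ℂ) (C : ℝ),
    (∀ᶠ k in l, ∑' n, ENNReal.ofReal ‖u k n‖ ≤ ENNReal.ofReal C) →
    (∀ ε > 0, ∀ᶠ k in l, ∀ n, ‖u k n‖ ≤ ε) → Tendsto (fun k => N (u k)) l (𝓝 0)

lemma tendsto_tsum_zero_of_dominated {ι : Type*} {l : Filter ι} {f : ι → ℤ → ℝ≥0∞}
    {b : ℤ → ℝ≥0∞} (hb : ∑' n, b n ≠ ∞) (hfb : ∀ᶠ k in l, ∀ n, f k n ≤ b n)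
    (hf : ∀ n, Tendsto (fun k => f k n) l (𝓝 0)) :
    Tendsto (fun k => ∑' n, f k n) l (𝓝 0) := by
  have hbn := ENNReal.ne_top_of_tsum_ne_top hb
  have h := tendsto_tsum_of_dominated_convergence (𝓕 := l) (f := fun k n => (f k n).toReal)
    (g := fun _ => 0) (ENNReal.summable_toReal hb)
    (fun n => by
      simpa [Function.comp_def] using (ENNReal.tendsto_toReal ENNReal.zero_ne_top).comp (hf n))
    (by filter_upwards [hfb] with k hk n
        simpa using ENNReal.toReal_mono (hbn n) (hk n))
  have h2 := ENNReal.tendsto_ofReal h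
  simp only [tsum_zero, ENNReal.ofReal_zero] at h2
  refine h2.congr' ?_
  filter_upwards [hfb] with k hk
  rw [← ENNReal.tsum_toReal_eq fun n => ne_top_of_le_ne_top (hbn n) (hk n),
    ENNReal.ofReal_toReal (ne_top_of_le_ne_top hb (ENNReal.tsum_le_tsum hk))]

lemma tsum_le_of_tendsto {ι : Type*} {l : Filter ι} [NeBot l] {f : ι → ℤ → ℝ≥0∞}
    {g : ℤ → ℝ≥0∞} {c : ℝ≥0∞} (hf : ∀ n, Tendsto (fun k => f k n) l (𝓝 (g n)))
    (hc : ∀ᶠ k in l, ∑' n, f k n ≤ c) : ∑' n, g n ≤ c := by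
  rw [ENNReal.tsum_eq_iSup_sum]
  refine iSup_le fun s => le_of_tendsto (tendsto_finsetSum s fun n _ => hf n) ?_
  filter_upwards [hc] with k hk using (ENNReal.sum_le_tsum s).trans hk

lemma isAdmissibleNorm_weightedL1Norm {w : ℕ → ℝ} (hw : ∀ n, 0 < w n) (hanti : Antitone w)
    (hlim : Tendsto w atTop (𝓝 0)) : IsAdmissibleNorm (weightedL1Norm w) where
  map_zero := by simp [weightedL1Norm]
  add_le a b := by
    unfold weightedL1Norm
    rw [← ENNReal.tsum_add]
    refine ENNReal.tsum_le_tsum fun n => ?_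
    have := (hw n.natAbs).le
    rw [← ENNReal.ofReal_add (by positivity) (by positivity), ← add_mul]
    exact ENNReal.ofReal_le_ofReal (mul_le_mul_of_nonneg_right (norm_add_le _ _) this)
  mono a b h := ENNReal.tsum_le_tsum fun n =>
    ENNReal.ofReal_le_ofReal (mul_le_mul_of_nonneg_right (h n) (hw _).le)
  eq_zero a h := by
    funext n
    have h1 := ENNReal.tsum_eq_zero.1 h n
    rw [ENNReal.ofReal_eq_zero] at h1
    by_contra h2
    exact absurd h1 (not_le.2 (mul_pos (norm_pos_iff.2 h2) (hw _)))
  fatou l _ u a c hu hc := tsum_le_of_tendsto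
    (fun n => ENNReal.tendsto_ofReal ((hu n).norm.mul_const _)) hc
  dominated l u b hb _ hub hu := by
    refine tendsto_tsum_zero_of_dominated hb.ne ?_ fun n => ?_
    · filter_upwards [hub] with k hk n
      exact ENNReal.ofReal_le_ofReal (mul_le_mul_of_nonneg_right (hk n) (hw _).le)
    · simpa using ENNReal.tendsto_ofReal ((hu n).norm.mul_const (w n.natAbs))
  small l u C hC hu := by
    rw [ENNReal.tendsto_nhds_zero]
    intro ε hε
    -- The tail `|n| ≥ m` is controlled by the `ℓ¹` bound, the rest by the bound on the entries.
    obtain ⟨η, hη, hηε⟩ : ∃ η : ℝ, 0 < η ∧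
        ENNReal.ofReal η * ENNReal.ofReal C + ENNReal.ofReal η ≤ ε := by
      have ht : Tendsto (fun η : ℝ => ENNReal.ofReal η * ENNReal.ofReal C + ENNReal.ofReal η)
          (𝓝[>] 0) (𝓝 0) := by
        have h0 : Tendsto (fun η : ℝ => ENNReal.ofReal η) (𝓝[>] 0) (𝓝 0) := by
          simpa using ENNReal.tendsto_ofReal
            ((tendsto_id (x := 𝓝 (0 : ℝ))).mono_left nhdsWithin_le_nhds)
        simpa using (ENNReal.Tendsto.mul_const h0 (Or.inr ENNReal.ofReal_ne_top)).add h0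
      obtain ⟨η, h1, h2⟩ := ((ENNReal.tendsto_nhds_zero.1 ht ε hε).and
        self_mem_nhdsWithin).exists
      exact ⟨η, h2, h1⟩
    obtain ⟨m, hm⟩ := (hlim.eventually (gt_mem_nhds hη)).exists
    set S : Finset ℤ := Finset.Icc (-(m : ℤ)) m
    have hS : 0 < (S.card : ℝ) := by
      have : (0 : ℤ) ∈ S := by simp [S]
      exact_mod_cast Finset.card_pos.2 ⟨0, this⟩
    filter_upwards [hC, hu (η / (w 0 * S.card)) (div_pos hη (mul_pos (hw 0) hS))] with k hk1 hk2
    refine le_trans ?_ hηε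
    have h1 : weightedL1Norm w (u k) ≤ ∑' n : ℤ, (ENNReal.ofReal η * ENNReal.ofReal ‖u k n‖ +
        (S : Set ℤ).indicator (fun _ => ENNReal.ofReal (η / S.card)) n) := by
      refine ENNReal.tsum_le_tsum fun n => ?_
      by_cases hn : n ∈ S
      · rw [indicator_of_mem (by exact_mod_cast hn)]
        refine le_add_left (ENNReal.ofReal_le_ofReal ?_)
        calc ‖u k n‖ * w n.natAbs ≤ η / (w 0 * S.card) * w 0 :=
              mul_le_mul (hk2 n) (hanti (Nat.zero_le _)) (hw _).le (by have := hw 0; positivity)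
          _ = η / S.card := by have := (hw 0).ne'; field_simp
      · rw [← ENNReal.ofReal_mul hη.le, mul_comm η]
        refine le_add_right (ENNReal.ofReal_le_ofReal ?_)
        refine mul_le_mul_of_nonneg_left ((hanti ?_).trans hm.le) (norm_nonneg _)
        simp only [S, Finset.mem_Icc] at hn
        omega
    refine h1.trans ?_
    rw [ENNReal.tsum_add, ENNReal.tsum_mul_left]
    refine add_le_add (by gcongr) (le_of_eq ?_)
    rw [tsum_eq_sum (s := S) fun n hn => indicator_of_notMem (by exact_mod_cast hn) _,
      Finset.sum_congr rfl fun n hn => indicator_of_mem (by exact_mod_cast hn) _,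
      Finset.sum_const, nsmul_eq_mul, ← ENNReal.ofReal_natCast, ← ENNReal.ofReal_mul hS.le]
    congr 1
    field_simp

/-! ### Orlicz norms -/

namespace IsYoungFunction

variable {Φ : ℝ → ℝ}

lemma nonneg_of_nonneg (h : IsYoungFunction Φ) {t : ℝ} (ht : 0 ≤ t) : 0 ≤ Φ t := by
  rcases ht.eq_or_lt with rfl | ht
  · exact h.map_zero.ge
  · exact h.nonneg t ht

lemma map_mul_le (h : IsYoungFunction Φ) (hm : MonotoneOn (fun t => Φ t / t) (Ioi 0))
    {q t : ℝ} (hq : 0 ≤ q) (hq1 : q ≤ 1) (ht : 0 ≤ t) : Φ (q * t) ≤ q * Φ t := by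
  rcases ht.eq_or_lt with rfl | ht
  · simp [h.map_zero]
  rcases hq.eq_or_lt with rfl | hq
  · simp [h.map_zero]
  have h1 : Φ (q * t) / (q * t) ≤ Φ t / t :=
    hm (mul_pos hq ht) ht (mul_le_of_le_one_left ht.le hq1)
  rw [div_le_iff₀ (mul_pos hq ht)] at h1
  refine h1.trans (le_of_eq ?_)
  field_simp

lemma monotoneOn (h : IsYoungFunction Φ) (hm : MonotoneOn (fun t => Φ t / t) (Ioi 0))
    {s t : ℝ} (hs : 0 ≤ s) (hst : s ≤ t) : Φ s ≤ Φ t := by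
  rcases (hs.trans hst).eq_or_lt with h0 | ht
  · rw [le_antisymm (h0 ▸ hst) hs, ← h0]
  have h1 := h.map_mul_le hm (div_nonneg hs ht.le) ((div_le_one ht).2 hst) ht.le
  rw [div_mul_cancel₀ _ ht.ne'] at h1
  exact h1.trans (mul_le_of_le_one_left (h.nonneg t ht) ((div_le_one ht).2 hst))

lemma map_convexCombination_le (h : IsYoungFunction Φ)
    (hm : MonotoneOn (fun t => Φ t / t) (Ioi 0)) {a b p q : ℝ} (ha : 0 ≤ a) (hb : 0 ≤ b)
    (hp : 0 ≤ p) (hq : 0 ≤ q) (hpq : p + q = 1) : Φ (p * a + q * b) ≤ p * Φ a + q * Φ b := by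
  rcases ha.eq_or_lt with rfl | ha
  · simpa [h.map_zero] using h.map_mul_le hm hq (by linarith) hb
  rcases hb.eq_or_lt with rfl | hb
  · simpa [h.map_zero] using h.map_mul_le hm hp (by linarith) ha.le
  exact h.convexOn.2 ha hb hp hq hpq

lemma continuousOn (h : IsYoungFunction Φ) : ContinuousOn Φ (Ici 0) := by
  intro t ht
  rcases (mem_Ici.1 ht).eq_or_lt with rfl | ht
  · rw [← Ioi_insert, continuousWithinAt_insert_self, ContinuousWithinAt, h.map_zero]
    exact h.tendsto_zero
  · exact ((h.convexOn.continuousOn isOpen_Ioi).continuousAt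
      (Ioi_mem_nhds ht)).continuousWithinAt

lemma tendsto_comp (h : IsYoungFunction Φ) {ι : Type*} {l : Filter ι} {u : ι → ℝ} {a : ℝ}
    (hu : Tendsto u l (𝓝 a)) (hu0 : ∀ k, 0 ≤ u k) (ha : 0 ≤ a) :
    Tendsto (fun k => Φ (u k)) l (𝓝 (Φ a)) :=
  (h.continuousOn a ha).tendsto.comp
    (tendsto_nhdsWithin_iff.2 ⟨hu, Eventually.of_forall hu0⟩)

/-- For a null sequence, the modular stays finite when the sequence is doubled: all but finitely
many terms are so small that the `Δ₂`-condition applies to them. -/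
lemma summable_two_mul (h : IsYoungFunction Φ) {c : ℤ → ℝ} (hc : ∀ n, 0 ≤ c n)
    (hlim : Tendsto c cofinite (𝓝 0)) (hs : Summable fun n => Φ (c n)) :
    Summable fun n => Φ (2 * c n) := by
  obtain ⟨C, hC⟩ := h.delta_two.2.bound
  have hC' : ∀ᶠ t in 𝓝 (0 : ℝ), 0 < t → ‖Φ t‖ ≤ C * ‖Φ (t / 2)‖ :=
    eventually_nhdsWithin_iff.1 hC
  have h2 : Tendsto (fun n => 2 * c n) cofinite (𝓝 0) := by simpa using hlim.const_mul 2
  refine Summable.of_norm_bounded_eventually (hs.mul_left C) ?_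
  filter_upwards [h2.eventually hC'] with n hn
  rcases (hc n).eq_or_lt with h0 | h0
  · simp [← h0, h.map_zero]
  · have := hn (by positivity)
    rwa [mul_div_cancel_left₀ _ (two_ne_zero' ℝ),
      Real.norm_of_nonneg (h.nonneg_of_nonneg (hc n))] at this

end IsYoungFunction

section Orlicz

variable {Φ : ℝ → ℝ}

lemma orliczNorm_le {a : ℤ → ℂ} {M : ℝ} (hM : 0 < M)
    (h : ∑' n : ℤ, ENNReal.ofReal (Φ (‖a n‖ / M)) ≤ 1) : orliczNorm Φ a ≤ ENNReal.ofReal M :=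
  iInf_le_of_le M (iInf_le_of_le hM (iInf_le _ h))

/-- The modular is monotone in the scale, so every `M` above the Luxemburg norm is admissible in the
infimum defining it. -/
lemma tsum_le_one_of_orliczNorm_lt (hΦ : IsYoungFunction Φ)
    (hm : MonotoneOn (fun t => Φ t / t) (Ioi 0)) {a : ℤ → ℂ} {M : ℝ}
    (h : orliczNorm Φ a < ENNReal.ofReal M) :
    ∑' n : ℤ, ENNReal.ofReal (Φ (‖a n‖ / M)) ≤ 1 := by
  simp only [orliczNorm, iInf_lt_iff] at h
  obtain ⟨M', hM', hs, hlt⟩ := h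
  have hMM : M' < M := (ENNReal.ofReal_lt_ofReal_iff_of_nonneg hM'.le).1 hlt
  refine (ENNReal.tsum_le_tsum fun n => ENNReal.ofReal_le_ofReal ?_).trans hs
  have := hM'.trans hMM
  exact hΦ.monotoneOn hm (by positivity) (by gcongr)

lemma le_of_forall_ofReal {x y : ℝ≥0∞} (h : ∀ M : ℝ, y < ENNReal.ofReal M → x ≤ ENNReal.ofReal M) :
    x ≤ y := by
  refine le_of_forall_gt_imp_ge_of_dense fun z hz => ?_
  by_cases hz' : z = ∞
  · simp [hz']
  · rw [← ENNReal.ofReal_toReal hz'] at hz ⊢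
    exact h _ hz

lemma pos_of_lt_ofReal {y : ℝ≥0∞} {M : ℝ} (h : y < ENNReal.ofReal M) : 0 < M :=
  ENNReal.ofReal_pos.1 (zero_le.trans_lt h)

lemma tendsto_orliczNorm_zero {ι : Type*} {l : Filter ι} {u : ι → ℤ → ℂ}
    (h : ∀ M : ℝ, 0 < M → ∀ᶠ k in l, ∑' n : ℤ, ENNReal.ofReal (Φ (‖u k n‖ / M)) ≤ 1) :
    Tendsto (fun k => orliczNorm Φ (u k)) l (𝓝 0) := by
  rw [ENNReal.tendsto_nhds_zero]
  intro ε hε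
  obtain ⟨M, hM, hMε⟩ : ∃ M : ℝ, 0 < M ∧ ENNReal.ofReal M ≤ ε := by
    obtain ⟨M, hM, hMε⟩ := ENNReal.lt_iff_exists_nnreal_btwn.1 hε
    exact ⟨M, by exact_mod_cast hM, by simpa using hMε.le⟩
  filter_upwards [h M hM] with k hk using (orliczNorm_le hM hk).trans hMε

/-- A null sequence in `ℓ^Φ` has finite modular at every scale `M`, not only at some scale. -/
lemma tsum_ne_top_of_orliczNorm_lt_top (hΦ : IsYoungFunction Φ)
    (hm : MonotoneOn (fun t => Φ t / t) (Ioi 0)) {b : ℤ → ℂ} (hb : orliczNorm Φ b < ∞)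
    (hb0 : Tendsto b cofinite (𝓝 0)) {M : ℝ} (hM : 0 < M) :
    ∑' n : ℤ, ENNReal.ofReal (Φ (‖b n‖ / M)) ≠ ∞ := by
  simp only [orliczNorm, iInf_lt_iff] at hb
  obtain ⟨M₀, hM₀, hs, -⟩ := hb
  have key : ∀ j : ℕ, Summable fun n => Φ (2 ^ j * (‖b n‖ / M₀)) := by
    intro j
    induction j with
    | zero =>
      have := ENNReal.summable_toReal (ne_top_of_le_ne_top ENNReal.one_ne_top hs)
      refine this.congr fun n => ?_
      rw [ENNReal.toReal_ofReal (hΦ.nonneg_of_nonneg (by positivity))]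
      simp
    | succ j ih =>
      have hlim : Tendsto (fun n => 2 ^ j * (‖b n‖ / M₀)) cofinite (𝓝 0) := by
        simpa using (hb0.norm.div_const M₀).const_mul (2 ^ j)
      refine (hΦ.summable_two_mul (fun n => by positivity) hlim ih).congr fun n => ?_
      rw [pow_succ]
      ring_nf
  obtain ⟨j, hj⟩ := pow_unbounded_of_one_lt (M₀ / M) (one_lt_two (α := ℝ))
  refine ne_top_of_le_ne_top (key j).tsum_ofReal_ne_top
    (ENNReal.tsum_le_tsum fun n => ENNReal.ofReal_le_ofReal (hΦ.monotoneOn hm (by positivity) ?_))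
  calc ‖b n‖ / M = M₀ / M * (‖b n‖ / M₀) := by field_simp
    _ ≤ 2 ^ j * (‖b n‖ / M₀) := by gcongr

lemma isAdmissibleNorm_orliczNorm (hΦ : IsYoungFunction Φ)
    (hm : MonotoneOn (fun t => Φ t / t) (Ioi 0))
    (hlim : Tendsto (fun t => Φ t / t) (𝓝[>] 0) (𝓝 0)) : IsAdmissibleNorm (orliczNorm Φ) where
  map_zero := by
    refine le_antisymm (le_of_forall_ofReal fun M hM => ?_) zero_le
    exact orliczNorm_le (pos_of_lt_ofReal hM) (by simp [hΦ.map_zero])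
  add_le a b := by
    by_cases hab : orliczNorm Φ a = ∞ ∨ orliczNorm Φ b = ∞
    · rcases hab with h | h <;> simp [h]
    push Not at hab
    refine ENNReal.le_of_forall_pos_le_add fun ε hε _ => ?_
    have hε2 : 0 < (ε : ℝ) / 2 := by positivity
    have haux : ∀ x : ℝ≥0∞, x ≠ ∞ → x < ENNReal.ofReal (x.toReal + ε / 2) := fun x hx => by
      rw [ENNReal.lt_ofReal_iff_toReal_lt hx]
      linarith
    set A := (orliczNorm Φ a).toReal + ε / 2
    set B := (orliczNorm Φ b).toReal + ε / 2
    have hA : 0 < A := by positivity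
    have hB : 0 < B := by positivity
    have h1 := tsum_le_one_of_orliczNorm_lt hΦ hm (haux _ hab.1)
    have h2 := tsum_le_one_of_orliczNorm_lt hΦ hm (haux _ hab.2)
    have h3 : orliczNorm Φ (a + b) ≤ ENNReal.ofReal (A + B) := by
      refine orliczNorm_le (by positivity) ?_
      set p := A / (A + B)
      set q := B / (A + B)
      have hpq : p + q = 1 := by simp only [p, q]; field_simp
      have hp : 0 ≤ p := by positivity
      have hq : 0 ≤ q := by positivity
      calc ∑' n : ℤ, ENNReal.ofReal (Φ (‖(a + b) n‖ / (A + B)))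
          ≤ ∑' n : ℤ, (ENNReal.ofReal p * ENNReal.ofReal (Φ (‖a n‖ / A)) +
              ENNReal.ofReal q * ENNReal.ofReal (Φ (‖b n‖ / B))) := by
            refine ENNReal.tsum_le_tsum fun n => ?_
            have hna := hΦ.nonneg_of_nonneg (t := ‖a n‖ / A) (by positivity)
            have hnb := hΦ.nonneg_of_nonneg (t := ‖b n‖ / B) (by positivity)
            rw [← ENNReal.ofReal_mul hp, ← ENNReal.ofReal_mul hq,
              ← ENNReal.ofReal_add (by positivity) (by positivity)]
            refine ENNReal.ofReal_le_ofReal (le_trans ?_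
              (hΦ.map_convexCombination_le hm (by positivity) (by positivity) hp hq hpq))
            refine hΦ.monotoneOn hm (by positivity) ?_
            calc ‖(a + b) n‖ / (A + B) ≤ (‖a n‖ + ‖b n‖) / (A + B) := by
                  gcongr; exact norm_add_le _ _
              _ = p * (‖a n‖ / A) + q * (‖b n‖ / B) := by simp only [p, q]; field_simp
        _ ≤ ENNReal.ofReal p * 1 + ENNReal.ofReal q * 1 := by
            rw [ENNReal.tsum_add, ENNReal.tsum_mul_left, ENNReal.tsum_mul_left]
            gcongr
        _ = 1 := by rw [mul_one, mul_one, ← ENNReal.ofReal_add hp hq, hpq, ENNReal.ofReal_one]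
    refine h3.trans (le_of_eq ?_)
    rw [show A + B = (orliczNorm Φ a).toReal + (orliczNorm Φ b).toReal + ε by
      simp only [A, B]; ring, ENNReal.ofReal_add (by positivity) (by positivity),
      ENNReal.ofReal_add (by positivity) (by positivity), ENNReal.ofReal_toReal hab.1,
      ENNReal.ofReal_toReal hab.2, ENNReal.ofReal_coe_nnreal]
  mono a b h := by
    refine le_of_forall_ofReal fun M hM => ?_
    have hM0 := pos_of_lt_ofReal hM
    refine orliczNorm_le hM0 (le_trans (ENNReal.tsum_le_tsum fun n => ENNReal.ofReal_le_ofReal ?_)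
      (tsum_le_one_of_orliczNorm_lt hΦ hm hM))
    exact hΦ.monotoneOn hm (by positivity) (by have := h n; gcongr)
  eq_zero a h := by
    funext n
    by_contra h0
    have ha : 0 < ‖a n‖ := norm_pos_iff.2 h0
    obtain ⟨t, ht, htΦ⟩ := hΦ.nontrivial
    have hpos : 0 < Φ t := lt_of_le_of_ne (hΦ.nonneg t ht) htΦ.symm
    -- `Φ s ≥ s Φ(t) / t` for `s ≥ t`, so `Φ` exceeds `1` at `s = t + 2 t / Φ t`.
    set s := t + 2 * t / Φ t
    have hts : t ≤ s := le_add_of_nonneg_right (by positivity)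
    have hs : 0 < s := ht.trans_le hts
    have h1 : Φ t / t ≤ Φ s / s := hm ht hs hts
    have h2 : 1 < Φ s := by
      rw [div_le_div_iff₀ ht hs] at h1
      have h3 : Φ t * s = Φ t * t + 2 * t := by simp only [s]; field_simp
      have : 0 < Φ t * t := by positivity
      by_contra! h4
      nlinarith
    have hM : orliczNorm Φ a < ENNReal.ofReal (‖a n‖ / s) := by
      rw [h]; exact ENNReal.ofReal_pos.2 (by positivity)
    have h4 := (ENNReal.le_tsum n).trans (tsum_le_one_of_orliczNorm_lt hΦ hm hM)
    rw [div_div_cancel₀ ha.ne', ENNReal.ofReal_le_one] at h4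
    exact absurd h4 (not_le.2 h2)
  fatou l _ u a c hu hc := by
    refine le_of_forall_ofReal fun M hM => ?_
    have hM0 := pos_of_lt_ofReal hM
    refine orliczNorm_le hM0 (tsum_le_of_tendsto (l := l) (fun n => ENNReal.tendsto_ofReal
      (hΦ.tendsto_comp ((hu n).norm.div_const M) (fun k => by positivity) (by positivity))) ?_)
    filter_upwards [hc] with k hk
    exact tsum_le_one_of_orliczNorm_lt hΦ hm (hk.trans_lt hM)
  dominated l u b hb hb0 hub hu := by
    refine tendsto_orliczNorm_zero fun M hM => ?_
    refine (tendsto_tsum_zero_of_dominated (tsum_ne_top_of_orliczNorm_lt_top hΦ hm hb hb0 hM)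
      ?_ fun n => ?_).eventually (ge_mem_nhds one_pos)
    · filter_upwards [hub] with k hk n
      exact ENNReal.ofReal_le_ofReal
        (hΦ.monotoneOn hm (by positivity) (by have := hk n; gcongr))
    · have := hΦ.tendsto_comp ((hu n).norm.div_const M) (fun k => by positivity) (by simp)
      simpa [hΦ.map_zero] using ENNReal.tendsto_ofReal this
  small l u C hC hu := by
    refine tendsto_orliczNorm_zero fun M hM => ?_
    -- `Φ t ≤ η t` for small `t`; the choice of `η` turns the `ℓ¹` bound `C` into `1`.
    set D := max C 1
    have hD : 0 < D := lt_max_of_lt_right one_pos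
    obtain ⟨δ, hδ, hδΦ⟩ := mem_nhdsGT_iff_exists_Ioc_subset.1
      (hlim.eventually (gt_mem_nhds (div_pos hM hD)))
    rw [mem_Ioi] at hδ
    filter_upwards [hC, hu (δ * M) (by positivity)] with k hk1 hk2
    calc ∑' n : ℤ, ENNReal.ofReal (Φ (‖u k n‖ / M))
        ≤ ∑' n : ℤ, ENNReal.ofReal D⁻¹ * ENNReal.ofReal ‖u k n‖ := by
          refine ENNReal.tsum_le_tsum fun n => ?_
          rw [← ENNReal.ofReal_mul (by positivity)]
          refine ENNReal.ofReal_le_ofReal ?_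
          rcases (norm_nonneg (u k n)).eq_or_lt with h0 | h0
          · simp [← h0, hΦ.map_zero]
          have h1 : 0 < ‖u k n‖ / M := by positivity
          have h2 : Φ (‖u k n‖ / M) / (‖u k n‖ / M) < M / D :=
            hδΦ ⟨h1, (div_le_iff₀ hM).2 (hk2 n)⟩
          rw [div_lt_iff₀ h1] at h2
          refine h2.le.trans (le_of_eq ?_)
          field_simp
      _ ≤ ENNReal.ofReal D⁻¹ * ENNReal.ofReal D := by
          rw [ENNReal.tsum_mul_left]
          gcongr
          exact hk1.trans (ENNReal.ofReal_le_ofReal (le_max_left _ _))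
      _ = 1 := by
          rw [← ENNReal.ofReal_mul (by positivity), inv_mul_cancel₀ hD.ne', ENNReal.ofReal_one]

end Orlicz

/-! ### Fourier coefficients on the circle -/

local notation "𝐦" => (haarAddCircle : Measure UnitAddCircle)

lemma haar_closedBall (x : UnitAddCircle) {r : ℝ} (hr : 2 * r ≤ 1) :
    𝐦 (Metric.closedBall x r) = ENNReal.ofReal (2 * r) := by
  have h : (volume : Measure UnitAddCircle) = 𝐦 := by
    rw [volume_eq_smul_haarAddCircle]; simp
  rw [← h, AddCircle.volume_closedBall, min_eq_right hr]

lemma norm_fourier_apply (n : ℤ) (t : UnitAddCircle) : ‖(fourier n t : ℂ)‖ = 1 := by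
  rw [fourier_apply, Circle.norm_coe]

lemma norm_fourierCoeff_le (F : UnitAddCircle → ℂ) (n : ℤ) :
    ‖fourierCoeff F n‖ ≤ ∫ t, ‖F t‖ ∂𝐦 := by
  refine (norm_integral_le_integral_norm _).trans (le_of_eq ?_)
  simp only [norm_smul, norm_fourier_apply, one_mul]

lemma hasSum_sq_norm_fourierCoeff {F : UnitAddCircle → ℂ} (hF : MemLp F 2 𝐦) :
    HasSum (fun n => ‖fourierCoeff F n‖ ^ 2) (∫ t, ‖F t‖ ^ 2 ∂𝐦) := by
  have h := hasSum_sq_fourierCoeff hF.toLp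
  rw [fourierCoeff_congr_ae hF.coeFn_toLp] at h
  convert h using 1
  refine integral_congr_ae ?_
  filter_upwards [hF.coeFn_toLp] with t ht
  rw [ht]

lemma tendsto_fourierCoeff_cofinite {F : UnitAddCircle → ℂ} (hF : MemLp F 2 𝐦) :
    Tendsto (fourierCoeff F) cofinite (𝓝 0) := by
  have h := (hasSum_sq_norm_fourierCoeff hF).summable.tendsto_cofinite_zero
  rw [tendsto_zero_iff_norm_tendsto_zero]
  simpa using h.sqrt

/-- The Fourier coefficients of the convolution of two square-integrable functions are summable;
`s` is a free parameter in the arithmetic-geometric mean inequality. -/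
lemma tsum_norm_fourierCoeff_mul_le {F G : UnitAddCircle → ℂ} (hF : MemLp F 2 𝐦)
    (hG : MemLp G 2 𝐦) {s : ℝ} (hs : 0 < s) :
    ∑' n, ENNReal.ofReal ‖fourierCoeff F n * fourierCoeff G n‖ ≤
      ENNReal.ofReal (s * (∫ t, ‖F t‖ ^ 2 ∂𝐦) + s⁻¹ * ∫ t, ‖G t‖ ^ 2 ∂𝐦) := by
  have h := ((hasSum_sq_norm_fourierCoeff hF).mul_left s).add
    ((hasSum_sq_norm_fourierCoeff hG).mul_left s⁻¹)
  rw [← h.tsum_eq, ENNReal.ofReal_tsum_of_nonneg (fun n => by positivity) h.summable]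
  refine ENNReal.tsum_le_tsum fun n => ENNReal.ofReal_le_ofReal ?_
  rw [norm_mul]
  set x := ‖fourierCoeff F n‖
  set y := ‖fourierCoeff G n‖
  have hx : 0 ≤ x := norm_nonneg _
  have hy : 0 ≤ y := norm_nonneg _
  have h1 : s * x ^ 2 + s⁻¹ * y ^ 2 - x * y = s⁻¹ * ((s * x - y) ^ 2 + s * x * y) := by
    field_simp; ring
  have h2 : 0 ≤ s⁻¹ * ((s * x - y) ^ 2 + s * x * y) := by positivity
  linarith

lemma fourierCoeff_convolution {F G : UnitAddCircle → ℂ} (hF : Integrable F 𝐦)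
    (hG : Integrable G 𝐦) (n : ℤ) :
    fourierCoeff (fun x => ∫ t, F t * G (x - t) ∂𝐦) n = fourierCoeff F n * fourierCoeff G n := by
  have h := integral_convolution (μ := 𝐦) (ν := 𝐦) (ContinuousLinearMap.mul ℝ ℂ)
    (hF.fourier_smul (-n)) (hG.fourier_smul (-n))
  rw [ContinuousLinearMap.mul_apply'] at h
  refine Eq.trans (integral_congr_ae (Eventually.of_forall fun x => ?_)) h
  simp only [convolution_def, ContinuousLinearMap.mul_apply', smul_eq_mul]
  rw [← integral_const_mul]
  refine integral_congr_ae (Eventually.of_forall fun t => ?_)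
  have h2 : (fourier (-n) x : ℂ) = fourier (-n) t * fourier (-n) (x - t) := by
    simp only [fourier_apply, ← Circle.coe_mul, ← toCircle_add, ← smul_add, add_sub_cancel]
  simp only [h2]
  ring

/-! ### Averages over short arcs -/

/-- The probability density `r⁻¹ 1_{[-r/2, r/2]}` on the circle. -/
noncomputable def arcKernel (r : ℝ) : UnitAddCircle → ℝ :=
  (Metric.closedBall 0 (r / 2)).indicator fun _ => r⁻¹

/-- The average of `F` over the arcs of length `r`, that is, the convolution with `arcKernel r`. -/
noncomputable def arcMean (F : UnitAddCircle → ℝ) (r : ℝ) (x : UnitAddCircle) : ℝ :=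
  ∫ t, arcKernel r t * F (x - t) ∂𝐦

lemma arcKernel_nonneg {r : ℝ} (hr : 0 < r) (t : UnitAddCircle) : 0 ≤ arcKernel r t :=
  indicator_nonneg (fun _ _ => (inv_pos.2 hr).le) _

lemma arcKernel_of_notMem {r : ℝ} {t : UnitAddCircle} (ht : t ∉ Metric.closedBall 0 (r / 2)) :
    arcKernel r t = 0 := indicator_of_notMem ht _

lemma measurable_arcKernel (r : ℝ) : Measurable (arcKernel r) :=
  measurable_const.indicator Metric.isClosed_closedBall.measurableSet

lemma arcKernel_le {r : ℝ} (hr : 0 < r) (t : UnitAddCircle) : arcKernel r t ≤ r⁻¹ :=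
  indicator_le_self' (fun _ _ => (inv_pos.2 hr).le) t

lemma integrable_arcKernel {r : ℝ} (hr : 0 < r) : Integrable (arcKernel r) 𝐦 :=
  .of_bound (measurable_arcKernel r).aestronglyMeasurable r⁻¹ (Eventually.of_forall fun t => by
    rw [Real.norm_of_nonneg (arcKernel_nonneg hr t)]; exact arcKernel_le hr t)

lemma integral_arcKernel_mul {r : ℝ} (hr : 0 < r) (hr1 : r ≤ 1) (c : ℝ) :
    ∫ t, arcKernel r t * c ∂𝐦 = c := by
  rw [integral_mul_const, arcKernel, integral_indicator Metric.isClosed_closedBall.measurableSet,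
    setIntegral_const, measureReal_def, haar_closedBall _ (by linarith),
    ENNReal.toReal_ofReal (by linarith)]
  simp only [smul_eq_mul]
  field_simp

lemma integral_sq_arcKernel {r : ℝ} (hr : 0 < r) (hr1 : r ≤ 1) :
    ∫ t, ‖(arcKernel r t : ℂ)‖ ^ 2 ∂𝐦 = r⁻¹ := by
  rw [← integral_arcKernel_mul hr hr1 r⁻¹]
  refine integral_congr_ae (Eventually.of_forall fun t => ?_)
  simp only [Complex.norm_real, Real.norm_eq_abs, sq_abs, arcKernel, indicator]
  split_ifs <;> ring

lemma memLp_of_bounded {F : UnitAddCircle → ℝ} (hF : Measurable F) {C : ℝ} (hC : ∀ x, |F x| ≤ C)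
    (p : ℝ≥0∞) : MemLp (fun x => (F x : ℂ)) p 𝐦 :=
  .of_bound (Complex.measurable_ofReal.comp hF).aestronglyMeasurable C
    (Eventually.of_forall fun x => by simpa using hC x)

lemma memLp_arcKernel {r : ℝ} (hr : 0 < r) (p : ℝ≥0∞) :
    MemLp (fun x => (arcKernel r x : ℂ)) p 𝐦 :=
  memLp_of_bounded (measurable_arcKernel r) (fun t => by
    rw [abs_of_nonneg (arcKernel_nonneg hr t)]; exact arcKernel_le hr t) p

lemma norm_fourierCoeff_arcKernel_le {r : ℝ} (hr : 0 < r) (hr1 : r ≤ 1) (n : ℤ) :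
    ‖fourierCoeff (fun x => (arcKernel r x : ℂ)) n‖ ≤ 1 := by
  refine (norm_fourierCoeff_le _ n).trans (le_of_eq ?_)
  simpa [abs_of_nonneg (arcKernel_nonneg hr _)] using integral_arcKernel_mul hr hr1 1

lemma tendsto_fourierCoeff_arcKernel (n : ℤ) :
    Tendsto (fun r => fourierCoeff (fun x => (arcKernel r x : ℂ)) n) (𝓝[>] 0) (𝓝 1) := by
  rw [Metric.tendsto_nhds]
  intro ε hε
  have hcont : Tendsto (fun t : UnitAddCircle => (fourier (-n) t : ℂ)) (𝓝 0) (𝓝 1) := by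
    have := (fourier (-n) : C(UnitAddCircle, ℂ)).continuous.tendsto 0
    rwa [fourier_eval_zero] at this
  obtain ⟨δ, hδ, hδε⟩ := Metric.eventually_nhds_iff.1
    (Metric.tendsto_nhds.1 hcont (ε / 2) (half_pos hε))
  filter_upwards [Ioc_mem_nhdsGT (show (0 : ℝ) < min 1 δ by positivity)] with r ⟨hr, hr2⟩
  have hr1 : r ≤ 1 := hr2.trans (min_le_left _ _)
  have hrδ : r ≤ δ := hr2.trans (min_le_right _ _)
  have hint : Integrable (fun x => (arcKernel r x : ℂ)) 𝐦 :=
    memLp_one_iff_integrable.1 (memLp_arcKernel hr 1)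
  have h1 : (1 : ℂ) = ∫ t, (arcKernel r t : ℂ) ∂𝐦 := by
    have := integral_arcKernel_mul hr hr1 1
    simp only [mul_one] at this
    rw [integral_complex_ofReal, this, Complex.ofReal_one]
  rw [dist_eq_norm, fourierCoeff, h1, ← integral_sub (hint.fourier_smul (-n)) hint]
  refine lt_of_le_of_lt ((norm_integral_le_integral_norm _).trans (integral_mono_of_nonneg
    (Eventually.of_forall fun t => norm_nonneg _)
    ((integrable_arcKernel hr).mul_const (ε / 2)) (Eventually.of_forall fun t => ?_)))
    ((integral_arcKernel_mul hr hr1 (ε / 2)).trans_lt (half_lt_self hε))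
  by_cases ht : t ∈ Metric.closedBall 0 (r / 2)
  · have h2 : dist t 0 < δ := (Metric.mem_closedBall.1 ht).trans_lt (by linarith)
    have h3 := (hδε h2).le
    rw [dist_eq_norm] at h3
    have h4 : (fourier (-n) t : ℂ) • (arcKernel r t : ℂ) - arcKernel r t =
        (arcKernel r t : ℂ) * (fourier (-n) t - 1) := by rw [smul_eq_mul]; ring
    simp only [h4, norm_mul, Complex.norm_real, Real.norm_of_nonneg (arcKernel_nonneg hr t)]
    exact mul_le_mul_of_nonneg_left h3 (arcKernel_nonneg hr t)
  · simp [arcKernel_of_notMem ht]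

section arcMean

variable {F : UnitAddCircle → ℝ} {C r : ℝ}

lemma memLp_of_nonneg_of_le (hF : Measurable F) (h0 : ∀ x, 0 ≤ F x) (hC : ∀ x, F x ≤ C)
    (p : ℝ≥0∞) : MemLp (fun x => (F x : ℂ)) p 𝐦 :=
  memLp_of_bounded hF (fun x => by rw [abs_of_nonneg (h0 x)]; exact hC x) p

lemma integrable_of_bounded (hF : Measurable F) (h0 : ∀ x, 0 ≤ F x) (hC : ∀ x, F x ≤ C) :
    Integrable F 𝐦 :=
  .of_bound hF.aestronglyMeasurable C (Eventually.of_forall fun t => by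
    rw [Real.norm_of_nonneg (h0 t)]; exact hC t)

lemma aestronglyMeasurable_arcMean (hF : Measurable F) (h0 : ∀ x, 0 ≤ F x) (hC : ∀ x, F x ≤ C)
    (hr : 0 < r) : AEStronglyMeasurable (arcMean F r) 𝐦 :=
  ((integrable_arcKernel hr).integrable_convolution (ContinuousLinearMap.mul ℝ ℝ)
    (integrable_of_bounded hF h0 hC)).aestronglyMeasurable

lemma arcMean_nonneg (h0 : ∀ x, 0 ≤ F x) (hr : 0 < r) (x : UnitAddCircle) : 0 ≤ arcMean F r x :=
  integral_nonneg fun t => mul_nonneg (arcKernel_nonneg hr t) (h0 _)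

lemma arcMean_le (h0 : ∀ x, 0 ≤ F x) (hC : ∀ x, F x ≤ C) (hr : 0 < r)
    (hr1 : r ≤ 1) (x : UnitAddCircle) : arcMean F r x ≤ C :=
  (integral_mono_of_nonneg
    (Eventually.of_forall fun t => mul_nonneg (arcKernel_nonneg hr t) (h0 _))
    ((integrable_arcKernel hr).mul_const C) (Eventually.of_forall fun t =>
      mul_le_mul_of_nonneg_left (hC _) (arcKernel_nonneg hr t))).trans_eq
    (integral_arcKernel_mul hr hr1 C)

lemma arcMean_eq_zero {x : UnitAddCircle} (h : ∀ y ∈ Metric.closedBall x (r / 2), F y = 0) :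
    arcMean F r x = 0 := by
  refine integral_eq_zero_of_ae (Eventually.of_forall fun t => ?_)
  by_cases ht : t ∈ Metric.closedBall 0 (r / 2)
  · have : F (x - t) = 0 := h _ (by simpa [dist_eq_norm] using ht)
    simp [this]
  · simp [arcKernel_of_notMem ht]

lemma fourierCoeff_arcMean (hF : Measurable F) (h0 : ∀ x, 0 ≤ F x) (hC : ∀ x, F x ≤ C)
    (hr : 0 < r) (n : ℤ) :
    fourierCoeff (fun x => (arcMean F r x : ℂ)) n =
      fourierCoeff (fun x => (arcKernel r x : ℂ)) n * fourierCoeff (fun x => (F x : ℂ)) n := by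
  rw [← fourierCoeff_convolution (memLp_one_iff_integrable.1 (memLp_arcKernel hr 1))
    (memLp_one_iff_integrable.1 (memLp_of_nonneg_of_le hF h0 hC 1))]
  congr 1
  funext x
  simp only [arcMean, ← integral_complex_ofReal, Complex.ofReal_mul]

end arcMean

/-! ### Fourier coefficients and supports of bounded densities -/

lemma memLp_ofReal (f : LInfCircle) (p : ℝ≥0∞) : MemLp (fun t => ((f t : ℝ) : ℂ)) p 𝐦 :=
  ((Lp.memLp f).mono_exponent le_top).ofReal

lemma fourierSeq_sub (f g : LInfCircle) : fourierSeq (f - g) = fourierSeq f - fourierSeq g := by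
  funext n
  have hf := memLp_one_iff_integrable.1 (memLp_ofReal f 1)
  have hg := memLp_one_iff_integrable.1 (memLp_ofReal g 1)
  simp only [fourierSeq, Pi.sub_apply, fourierCoeff]
  rw [← integral_sub (hf.fourier_smul (-n)) (hg.fourier_smul (-n))]
  refine integral_congr_ae ?_
  filter_upwards [Lp.coeFn_sub f g] with t ht
  rw [ht, Pi.sub_apply, Complex.ofReal_sub, smul_sub]

lemma fourierSeq_eq_of_ae {f : LInfCircle} {F : UnitAddCircle → ℝ} (h : f =ᵐ[𝐦] F) :
    fourierSeq f = fourierCoeff fun t => (F t : ℂ) := by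
  funext n
  have h' : (fun t => ((f t : ℝ) : ℂ)) =ᵐ[𝐦] fun t => (F t : ℂ) := by
    filter_upwards [h] with t ht
    rw [ht]
  rw [fourierSeq, fourierCoeff_congr_ae h']

lemma eq_zero_of_fourierSeq_eq_zero {f : LInfCircle} (h : fourierSeq f = 0) : f = 0 := by
  have h1 := hasSum_sq_norm_fourierCoeff (memLp_ofReal f 2)
  have h2 : fourierCoeff (fun t => ((f t : ℝ) : ℂ)) = 0 := h
  simp only [h2, Pi.zero_apply, norm_zero, ne_eq, OfNat.ofNat_ne_zero, not_false_eq_true,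
    zero_pow, Complex.norm_real] at h1
  have h3 := hasSum_zero.unique h1
  have hint : Integrable (fun t => ‖f t‖ ^ 2) 𝐦 :=
    MemLp.integrable_norm_pow (p := 2) ((Lp.memLp f).mono_exponent le_top) two_ne_zero
  have h4 := (integral_eq_zero_iff_of_nonneg (fun t => by positivity) hint).1 h3.symm
  rw [Lp.eq_zero_iff_ae_eq_zero]
  filter_upwards [h4] with t ht
  simpa using ht

/-- For `f ≥ 0` and closed `K`, the support condition says that `f` vanishes a.e. off `K`. -/
lemma densitySupport_subset_iff {f : LInfCircle} (h0 : ∀ᵐ t ∂𝐦, 0 ≤ f t)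
    {K : Set UnitAddCircle} (hK : IsClosed K) :
    densitySupport f ⊆ K ↔ ∀ᵐ t ∂𝐦, t ∉ K → f t = 0 := by
  have hmeas : AEMeasurable (fun t => ENNReal.ofReal (f t)) 𝐦 :=
    (Lp.stronglyMeasurable f).measurable.ennreal_ofReal.aemeasurable
  have h1 : densitySupport f ⊆ K ↔
      ((𝐦).withDensity fun t => ENNReal.ofReal (f t)) Kᶜ = 0 :=
    ⟨fun h => measure_mono_null (compl_subset_compl.2 h) Measure.measure_compl_support,
      fun h => Measure.support_subset_of_isClosed hK (mem_ae_iff.2 h)⟩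
  rw [h1, withDensity_apply_eq_zero' hmeas, ← compl_mem_ae_iff]
  refine eventually_congr (h0.mono fun t ht => ?_)
  simp only [ne_eq, ENNReal.ofReal_eq_zero, not_le, mem_compl_iff, mem_inter_iff, mem_ofPred_eq,
    not_and, not_not]
  constructor
  · intro h htK
    by_contra h2
    exact htK (h (lt_of_le_of_ne ht (Ne.symm h2)))
  · intro h hpos
    by_contra htK
    exact hpos.ne' (h htK)

/-! ### The metric on pairs -/

section Hausdorff

variable (E F G : NonemptyCompacts UnitAddCircle)

lemma hausdorffSumDist_comm : hausdorffSumDist E F = hausdorffSumDist F E := add_comm _ _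

lemma edist_le_hausdorffSumDist : edist E F ≤ hausdorffSumDist E F := by
  have h : edist E F = Metric.hausdorffEDist (E : Set UnitAddCircle) F := rfl
  rw [h, Metric.hausdorffEDist_def]
  exact max_le le_add_self le_self_add

lemma hausdorffSumDist_le : hausdorffSumDist E F ≤ edist E F + edist E F := by
  have h : edist E F = Metric.hausdorffEDist (E : Set UnitAddCircle) F := rfl
  rw [h, Metric.hausdorffEDist_def]
  exact add_le_add (le_max_right _ _) (le_max_left _ _)

lemma iSup_infEDist_triangle :
    ⨆ ξ ∈ (E : Set UnitAddCircle), Metric.infEDist ξ (G : Set UnitAddCircle) ≤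
      (⨆ ξ ∈ (E : Set UnitAddCircle), Metric.infEDist ξ (F : Set UnitAddCircle)) +
        ⨆ ξ ∈ (F : Set UnitAddCircle), Metric.infEDist ξ (G : Set UnitAddCircle) := by
  refine iSup₂_le fun ξ hξ => ?_
  obtain ⟨ζ, hζ, h⟩ := F.isCompact.exists_infEDist_eq_edist F.nonempty ξ
  calc Metric.infEDist ξ (G : Set UnitAddCircle)
      ≤ edist ξ ζ + Metric.infEDist ζ (G : Set UnitAddCircle) :=
        Metric.infEDist_le_edist_add_infEDist
    _ ≤ _ := by
        rw [← h]
        exact add_le_add (le_iSup₂_of_le ξ hξ le_rfl) (le_iSup₂_of_le ζ hζ le_rfl)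

lemma hausdorffSumDist_triangle :
    hausdorffSumDist E G ≤ hausdorffSumDist E F + hausdorffSumDist F G := by
  refine (add_le_add (iSup_infEDist_triangle G F E) (iSup_infEDist_triangle E F G)).trans
    (le_of_eq ?_)
  simp only [hausdorffSumDist]
  ring

end Hausdorff

section Metric

variable {N : (ℤ → ℂ) → ℝ≥0∞}

lemma IsAdmissibleNorm.congr_norm (hN : IsAdmissibleNorm N) {a b : ℤ → ℂ}
    (h : ∀ n, ‖a n‖ = ‖b n‖) : N a = N b :=
  le_antisymm (hN.mono _ _ fun n => (h n).le) (hN.mono _ _ fun n => (h n).ge)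

lemma IsAdmissibleNorm.sub_comm (hN : IsAdmissibleNorm N) (a b : ℤ → ℂ) :
    N (a - b) = N (b - a) := hN.congr_norm fun _ => norm_sub_rev _ _

lemma IsAdmissibleNorm.sub_triangle (hN : IsAdmissibleNorm N) (a b c : ℤ → ℂ) :
    N (a - c) ≤ N (a - b) + N (b - c) := by
  simpa using hN.add_le (a - b) (b - c)

lemma pairDist_eq (p q : SupportPair N) :
    pairDist N p q = hausdorffSumDist p.E q.E + N (fourierSeq p.f - fourierSeq q.f) := by
  rw [pairDist, fourierSeq_sub]

lemma pairDist_ne_top (hN : IsAdmissibleNorm N) (p q : SupportPair N) : pairDist N p q ≠ ∞ := by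
  rw [pairDist_eq]
  refine ENNReal.add_ne_top.2 ⟨ne_top_of_le_ne_top
    (ENNReal.add_ne_top.2 ⟨edist_ne_top _ _, edist_ne_top _ _⟩) (hausdorffSumDist_le _ _), ?_⟩
  have := hN.sub_triangle (fourierSeq p.f) 0 (fourierSeq q.f)
  rw [hN.sub_comm 0, sub_zero, sub_zero] at this
  exact ne_top_of_le_ne_top (ENNReal.add_ne_top.2 ⟨p.mem_X.ne, q.mem_X.ne⟩) this

lemma SupportPair.ext' {p q : SupportPair N} (hf : p.f = q.f) (hE : p.E = q.E) : p = q := by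
  cases p; cases q; cases hf; cases hE; rfl

/-- `pairDist` as an extended metric. -/
@[reducible] noncomputable def SupportPair.emetricSpace (hN : IsAdmissibleNorm N) :
    EMetricSpace (SupportPair N) where
  edist := pairDist N
  edist_self p := by
    rw [pairDist_eq, sub_self, hN.map_zero, add_zero]
    exact le_antisymm (by simpa using hausdorffSumDist_le p.E p.E) zero_le
  edist_comm p q := by
    rw [pairDist_eq, pairDist_eq, hausdorffSumDist_comm, hN.sub_comm]
  edist_triangle p q r := by
    rw [pairDist_eq, pairDist_eq, pairDist_eq]
    refine (add_le_add (hausdorffSumDist_triangle p.E q.E r.E)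
      (hN.sub_triangle _ (fourierSeq q.f) _)).trans (le_of_eq (by ring))
  eq_of_edist_eq_zero {p q} h := by
    obtain ⟨h1, h2⟩ := add_eq_zero.1 h
    refine SupportPair.ext' (sub_eq_zero.1 (eq_zero_of_fourierSeq_eq_zero (hN.eq_zero _ h2))) ?_
    exact edist_eq_zero.1 (le_antisymm ((edist_le_hausdorffSumDist _ _).trans h1.le) zero_le)

/-- `pairDist` as a metric. -/
@[reducible] noncomputable def SupportPair.metricSpace (hN : IsAdmissibleNorm N) :
    MetricSpace (SupportPair N) :=
  letI := SupportPair.emetricSpace hN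
  EMetricSpace.toMetricSpace (pairDist_ne_top hN)

end Metric

/-! ### Weak limits and completeness -/

lemma norm_toLp_two_le {f : LInfCircle} (hf : ∀ᵐ t ∂𝐦, 0 ≤ f t ∧ f t ≤ 10)
    (h2 : MemLp f 2 𝐦) : ‖h2.toLp‖ ≤ 10 := by
  have := Lp.norm_le_of_ae_bound (f := h2.toLp) (C := 10) (by norm_num) (by
    filter_upwards [hf, h2.coeFn_toLp] with t ht h
    rw [h, Real.norm_of_nonneg ht.1]
    exact ht.2)
  simpa [measureUnivNNReal] using this

/-- Weak compactness: bounded densities converge weakly in `L²` along every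
ultrafilter, by the Banach–Alaoglu theorem, and the limit obeys the same bounds. -/
lemma exists_weak_limit (f : ℕ → LInfCircle) (hf : ∀ k, ∀ᵐ t ∂𝐦, 0 ≤ f k t ∧ f k t ≤ 10)
    (U : Ultrafilter ℕ) :
    ∃ g : LInfCircle, (∀ᵐ t ∂𝐦, 0 ≤ g t ∧ g t ≤ 10) ∧
      ∀ φ : UnitAddCircle → ℝ, MemLp φ 2 𝐦 →
        Tendsto (fun k => ∫ t, φ t * f k t ∂𝐦) U (𝓝 (∫ t, φ t * g t ∂𝐦)) := by
  have h2 : ∀ k, MemLp (f k) 2 𝐦 := fun k => (Lp.memLp (f k)).mono_exponent le_top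
  let L : ℕ → WeakDual ℝ (Lp ℝ 2 𝐦) := fun k => StrongDual.toWeakDual (innerSL ℝ (h2 k).toLp)
  obtain ⟨Λ, -, hΛ⟩ := (WeakDual.isCompact_closedBall (0 : StrongDual ℝ (Lp ℝ 2 𝐦)) 10
    ).ultrafilter_le_nhds (U.map L) (by
      rw [Ultrafilter.coe_map, le_principal_iff, mem_map]
      refine univ_mem' fun k => ?_
      simp only [L, mem_preimage, Metric.mem_closedBall, dist_zero_right]
      exact (innerSL_apply_norm ℝ _).trans_le (norm_toLp_two_le (hf k) (h2 k)))
  have hΛ' : Tendsto L U (𝓝 Λ) := hΛ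
  set G : Lp ℝ 2 𝐦 := (InnerProductSpace.toDual ℝ _).symm (WeakDual.toStrongDual Λ)
  have hG : ∀ φ : UnitAddCircle → ℝ, MemLp φ 2 𝐦 →
      Tendsto (fun k => ∫ t, φ t * f k t ∂𝐦) U (𝓝 (∫ t, φ t * G t ∂𝐦)) := by
    intro φ hφ
    have h3 := ((WeakDual.eval_continuous hφ.toLp).tendsto Λ).comp hΛ'
    have h4 : Λ hφ.toLp = ∫ t, φ t * G t ∂𝐦 := by
      have : inner ℝ G hφ.toLp = Λ hφ.toLp := InnerProductSpace.toDual_symm_apply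
      rw [← this, L2.inner_def]
      refine integral_congr_ae ?_
      filter_upwards [hφ.coeFn_toLp] with t ht
      simp [ht]
    rw [h4] at h3
    refine h3.congr fun k => ?_
    have : L k hφ.toLp = inner ℝ (h2 k).toLp hφ.toLp := rfl
    simp only [Function.comp_apply]
    rw [this, L2.inner_def]
    refine integral_congr_ae ?_
    filter_upwards [hφ.coeFn_toLp, (h2 k).coeFn_toLp] with t ht ht2
    simp [ht, ht2]
  have hGint : Integrable G 𝐦 := (Lp.memLp G).integrable one_le_two
  have hset : ∀ s, MeasurableSet s →
      Tendsto (fun k => ∫ t in s, f k t ∂𝐦) U (𝓝 (∫ t in s, G t ∂𝐦)) := by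
    intro s hs
    have := hG (s.indicator 1) ((memLp_const 1).indicator hs)
    simpa [← integral_indicator hs, indicator_mul_left, indicator, ite_mul] using this
  have h0 : ∀ᵐ t ∂𝐦, 0 ≤ G t := by
    refine ae_nonneg_of_forall_setIntegral_nonneg hGint fun s hs _ => ?_
    exact ge_of_tendsto (hset s hs) (Eventually.of_forall fun k =>
      integral_nonneg_of_ae (ae_restrict_of_ae ((hf k).mono fun t ht => ht.1)))
  have h10 : ∀ᵐ t ∂𝐦, 0 ≤ 10 - G t := by
    refine ae_nonneg_of_forall_setIntegral_nonneg ((integrable_const _).sub hGint) fun s hs _ => ?_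
    have h5 := (hset s hs).const_sub (∫ _ in s, 10 ∂𝐦)
    rw [← integral_sub (integrable_const _).integrableOn hGint.integrableOn] at h5
    refine ge_of_tendsto h5 (Eventually.of_forall fun k => ?_)
    rw [← integral_sub (integrable_const _).integrableOn
      ((h2 k).integrable one_le_two).integrableOn]
    exact integral_nonneg_of_ae (ae_restrict_of_ae ((hf k).mono fun t ht => sub_nonneg.2 ht.2))
  have hmem : MemLp G ∞ 𝐦 := memLp_top_of_bound (Lp.memLp G).1 10 (by
    filter_upwards [h0, h10] with t ht ht'
    rw [Real.norm_of_nonneg ht]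
    linarith)
  refine ⟨hmem.toLp, ?_, fun φ hφ => ?_⟩
  · filter_upwards [h0, h10, hmem.coeFn_toLp] with t ht ht' h
    rw [h]
    exact ⟨ht, by linarith⟩
  · have h6 : ∫ t, φ t * hmem.toLp G t ∂𝐦 = ∫ t, φ t * G t ∂𝐦 := by
      refine integral_congr_ae ?_
      filter_upwards [hmem.coeFn_toLp] with t ht
      rw [ht]
    rw [h6]
    exact hG φ hφ

lemma fourierSeq_eq_add (f : LInfCircle) (n : ℤ) :
    fourierSeq f n = ((∫ t, (fourier (-n) t : ℂ).re * f t ∂𝐦 : ℝ) : ℂ) +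
      ((∫ t, (fourier (-n) t : ℂ).im * f t ∂𝐦 : ℝ) : ℂ) * Complex.I := by
  have hint : Integrable (fun t => (fourier (-n) t : ℂ) • ((f t : ℝ) : ℂ)) 𝐦 :=
    (memLp_one_iff_integrable.1 (memLp_ofReal f 1)).fourier_smul (-n)
  have h := integral_re_add_im hint
  simp only [smul_eq_mul, RCLike.re_to_complex, RCLike.im_to_complex, Complex.re_mul_ofReal,
    Complex.im_mul_ofReal, RCLike.I_to_complex, Complex.coe_algebraMap] at h
  exact h.symm

lemma tendsto_fourierSeq {f : ℕ → LInfCircle} {g : LInfCircle} {l : Filter ℕ}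
    (h : ∀ φ : UnitAddCircle → ℝ, MemLp φ 2 𝐦 →
      Tendsto (fun k => ∫ t, φ t * f k t ∂𝐦) l (𝓝 (∫ t, φ t * g t ∂𝐦))) (n : ℤ) :
    Tendsto (fun k => fourierSeq (f k) n) l (𝓝 (fourierSeq g n)) := by
  simp only [fourierSeq_eq_add]
  have hc := (fourier (-n) : C(UnitAddCircle, ℂ)).continuous
  have hb : ∀ t : UnitAddCircle, ‖(fourier (-n) t : ℂ)‖ ≤ 1 :=
    fun t => (norm_fourier_apply _ _).le
  have h1 := h (fun t => (fourier (-n) t : ℂ).re) (.of_bound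
    (Complex.continuous_re.comp hc).aestronglyMeasurable 1
    (Eventually.of_forall fun t => (Complex.abs_re_le_norm _).trans (hb t)))
  have h2 := h (fun t => (fourier (-n) t : ℂ).im) (.of_bound
    (Complex.continuous_im.comp hc).aestronglyMeasurable 1
    (Eventually.of_forall fun t => (Complex.abs_im_le_norm _).trans (hb t)))
  exact ((Complex.continuous_ofReal.tendsto _).comp h1).add
    (((Complex.continuous_ofReal.tendsto _).comp h2).mul_const _)

lemma subset_cthickening_of_edist_le {E F : NonemptyCompacts UnitAddCircle} {δ : ℝ}
    (h : edist F E ≤ ENNReal.ofReal δ) :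
    (F : Set UnitAddCircle) ⊆ Metric.cthickening δ (E : Set UnitAddCircle) :=
  fun _ hx => (Metric.infEDist_le_hausdorffEDist_of_mem hx).trans h

/-- Supports pass to the limit: a weak limit of densities carried by sets `E k` is carried by the
Hausdorff limit of the `E k`. -/
lemma densitySupport_subset_of_tendsto {f : ℕ → LInfCircle} {g : LInfCircle}
    {E : ℕ → NonemptyCompacts UnitAddCircle} {F : NonemptyCompacts UnitAddCircle}
    {l : Filter ℕ} [NeBot l] (hf0 : ∀ k, ∀ᵐ t ∂𝐦, 0 ≤ f k t) (hg0 : ∀ᵐ t ∂𝐦, 0 ≤ g t)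
    (hfE : ∀ k, densitySupport (f k) ⊆ E k) (hE : Tendsto E l (𝓝 F))
    (h : ∀ φ : UnitAddCircle → ℝ, MemLp φ 2 𝐦 →
      Tendsto (fun k => ∫ t, φ t * f k t ∂𝐦) l (𝓝 (∫ t, φ t * g t ∂𝐦))) :
    densitySupport g ⊆ F := by
  rw [← F.isCompact.isClosed.closure_eq, Metric.closure_eq_iInter_cthickening]
  refine subset_iInter₂ fun δ hδ => ?_
  rw [densitySupport_subset_iff hg0 Metric.isClosed_cthickening]
  set A : Set UnitAddCircle := (Metric.cthickening δ (F : Set UnitAddCircle))ᶜ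
  have hA : MeasurableSet A := Metric.isClosed_cthickening.measurableSet.compl
  have h1 := h (A.indicator 1) ((memLp_const 1).indicator hA)
  have h2 : ∀ u : UnitAddCircle → ℝ,
      ∫ t, A.indicator 1 t * u t ∂𝐦 = ∫ t in A, u t ∂𝐦 := fun u => by
    simp [← integral_indicator hA, indicator, ite_mul]
  simp only [h2] at h1
  have h3 : ∀ᶠ k in l, ∫ t in A, f k t ∂𝐦 = 0 := by
    filter_upwards [hE.eventually (Metric.eball_mem_nhds F (ENNReal.ofReal_pos.2 hδ))] with k hk
    refine integral_eq_zero_of_ae ?_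
    filter_upwards [ae_restrict_mem hA, ae_restrict_of_ae ((densitySupport_subset_iff (hf0 k)
      (E k).isCompact.isClosed).1 (hfE k))] with t ht h4
    exact h4 fun h5 => ht (subset_cthickening_of_edist_le hk.le h5)
  have h4 : ∫ t in A, g t ∂𝐦 = 0 :=
    tendsto_nhds_unique h1 (tendsto_const_nhds.congr' (h3.mono fun _ hk => hk.symm))
  rw [setIntegral_eq_zero_iff_of_nonneg_ae (ae_restrict_of_ae hg0)
    ((Lp.memLp g).integrable le_top).integrableOn, EventuallyEq, ae_restrict_iff' hA] at h4
  exact h4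

lemma SupportPair.completeSpace {N : (ℤ → ℂ) → ℝ≥0∞} (hN : IsAdmissibleNorm N) :
    letI := SupportPair.metricSpace hN
    CompleteSpace (SupportPair N) := by
  let _ := SupportPair.metricSpace hN
  refine EMetric.complete_of_cauchySeq_tendsto fun u hu => ?_
  rw [EMetric.cauchySeq_iff] at hu
  have hd : ∀ p q : SupportPair N, edist p q = hausdorffSumDist p.E q.E +
    N (fourierSeq p.f - fourierSeq q.f) := pairDist_eq
  simp only [hd] at hu
  have hEc : CauchySeq fun k => (u k).E := EMetric.cauchySeq_iff.2 fun ε hε => by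
    obtain ⟨K, hK⟩ := hu ε hε
    exact ⟨K, fun m hm n hn => ((edist_le_hausdorffSumDist _ _).trans le_self_add).trans_lt
      (hK m hm n hn)⟩
  obtain ⟨E, hE⟩ := cauchySeq_tendsto_of_complete hEc
  set U : Ultrafilter ℕ := Ultrafilter.of atTop
  have hU : (U : Filter ℕ) ≤ atTop := Ultrafilter.of_le _
  -- No subsequence is extracted: the limit is taken along an ultrafilter, and the Fatou property of
  -- the norm turns it into convergence of the whole Cauchy sequence.
  obtain ⟨g, hg, hlim⟩ := exists_weak_limit (fun k => (u k).f) (fun k => (u k).bounds) U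
  have hN0 : ∀ ε > 0, ∃ K, ∀ m ≥ K, N (fourierSeq (u m).f - fourierSeq g) ≤ ε := by
    intro ε hε
    obtain ⟨K, hK⟩ := hu ε hε
    refine ⟨K, fun m hm => hN.fatou (U : Filter ℕ)
      (fun k => fourierSeq (u m).f - fourierSeq (u k).f) _ ε
      (fun n => (tendsto_fourierSeq hlim n).const_sub _) ?_⟩
    filter_upwards [hU (eventually_ge_atTop K)] with k hk
    exact le_add_self.trans (hK m hm k hk).le
  have hgX : N (fourierSeq g) < ∞ := by
    obtain ⟨K, hK⟩ := hN0 1 one_pos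
    have h1 := hN.add_le (fourierSeq g - fourierSeq (u K).f) (fourierSeq (u K).f)
    rw [sub_add_cancel, hN.sub_comm] at h1
    exact h1.trans_lt (ENNReal.add_lt_top.2
      ⟨(hK K le_rfl).trans_lt ENNReal.one_lt_top, (u K).mem_X⟩)
  have hsupp : densitySupport g ⊆ E :=
    densitySupport_subset_of_tendsto (fun k => (u k).bounds.mono fun _ ht => ht.1)
      (hg.mono fun _ ht => ht.1) (fun k => (u k).support_subset) (hE.mono_left hU) hlim
  refine ⟨⟨g, E, hsupp, hg, hgX⟩, ?_⟩
  rw [tendsto_iff_edist_tendsto_0]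
  have h1 : Tendsto (fun k => N (fourierSeq (u k).f - fourierSeq g)) atTop (𝓝 0) :=
    ENNReal.tendsto_atTop_zero.2 hN0
  have h2 : Tendsto (fun k => edist (u k).E E) atTop (𝓝 0) := tendsto_iff_edist_tendsto_0.1 hE
  refine tendsto_of_tendsto_of_tendsto_of_le_of_le tendsto_const_nhds
    (by simpa using (h2.add h2).add h1) (fun _ => zero_le) fun k => ?_
  simp only [hd]
  exact add_le_add (hausdorffSumDist_le _ _) le_rfl

/-! ### Pairs whose set omits a given point -/

/-- An everywhere defined representative of the density of `p`, with `0 ≤ p.density ≤ 10` and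
`p.density = 0` off `p.E` at every point. -/
noncomputable def SupportPair.density {N : (ℤ → ℂ) → ℝ≥0∞} (p : SupportPair N) :
    UnitAddCircle → ℝ :=
  (p.E : Set UnitAddCircle).indicator fun t => max 0 (min 10 (p.f t))

section Density

variable {N : (ℤ → ℂ) → ℝ≥0∞} (p : SupportPair N)

lemma SupportPair.measurable_density : Measurable p.density :=
  (measurable_const.max (measurable_const.min
    (Lp.stronglyMeasurable p.f).measurable)).indicator p.E.isCompact.isClosed.measurableSet

lemma SupportPair.density_nonneg (t : UnitAddCircle) : 0 ≤ p.density t :=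
  indicator_nonneg (fun _ _ => le_max_left _ _) _

lemma SupportPair.density_le (t : UnitAddCircle) : p.density t ≤ 10 :=
  indicator_apply_le' (fun _ => max_le (by norm_num) (min_le_left _ _)) (fun _ => by norm_num)

lemma SupportPair.density_ae_eq : p.f =ᵐ[𝐦] p.density := by
  have h := (densitySupport_subset_iff (p.bounds.mono fun _ ht => ht.1)
    p.E.isCompact.isClosed).1 p.support_subset
  filter_upwards [h, p.bounds] with t ht hb
  by_cases htE : t ∈ (p.E : Set UnitAddCircle)
  · rw [density, indicator_of_mem htE, min_eq_right hb.2, max_eq_right hb.1]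
  · rw [density, indicator_of_notMem htE, ht htE]

end Density

lemma integral_le_of_le_indicator_closedBall {φ : UnitAddCircle → ℝ} {x : UnitAddCircle} {r c : ℝ}
    (hr0 : 0 ≤ r) (hr : 2 * r ≤ 1) (h0 : ∀ t, 0 ≤ φ t)
    (hφ : ∀ t, φ t ≤ (Metric.closedBall x r).indicator (fun _ => c) t) :
    ∫ t, φ t ∂𝐦 ≤ 2 * r * c := by
  have hm : MeasurableSet (Metric.closedBall x r) := Metric.isClosed_closedBall.measurableSet
  refine (integral_mono_of_nonneg (Eventually.of_forall h0)
    ((integrable_const c).indicator hm) (Eventually.of_forall hφ)).trans (le_of_eq ?_)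
  rw [integral_indicator hm, setIntegral_const, measureReal_def, haar_closedBall _ hr,
    ENNReal.toReal_ofReal (by linarith), smul_eq_mul]

section Approximation

variable {N : (ℤ → ℂ) → ℝ≥0∞}

lemma tendsto_norm_mul_one_sub_arcKernel (hN : IsAdmissibleNorm N) (p : SupportPair N) :
    Tendsto (fun r => N fun n =>
      (1 - fourierCoeff (fun x => (arcKernel r x : ℂ)) n) * fourierSeq p.f n)
      (𝓝[>] 0) (𝓝 0) := by
  have hc : Tendsto (fourierSeq p.f) cofinite (𝓝 0) :=
    tendsto_fourierCoeff_cofinite (memLp_ofReal p.f 2)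
  refine hN.dominated (𝓝[>] 0) _ (fourierSeq p.f + fourierSeq p.f) ?_ ?_ ?_ fun n => ?_
  · exact (hN.add_le _ _).trans_lt (ENNReal.add_lt_top.2 ⟨p.mem_X, p.mem_X⟩)
  · simpa [Pi.add_def] using hc.add hc
  · filter_upwards [Ioc_mem_nhdsGT one_pos] with r hr n
    rw [norm_mul, Pi.add_apply, ← two_mul, norm_mul]
    refine mul_le_mul_of_nonneg_right ((norm_sub_le _ _).trans ?_) (norm_nonneg _)
    have := norm_fourierCoeff_arcKernel_le hr.1 hr.2 n
    simp only [norm_one, Complex.norm_ofNat]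
    linarith
  · simpa using ((tendsto_fourierCoeff_arcKernel n).const_sub 1).mul_const (fourierSeq p.f n)

/-- A bounded function restricted to an arc of length `2 r`, then averaged over arcs of length `r`,
has Fourier coefficients that are bounded in `ℓ¹` by Parseval's identity and tend uniformly to `0`
as `r → 0`. -/
lemma tendsto_norm_indicator_mul_arcKernel (hN : IsAdmissibleNorm N) {F : UnitAddCircle → ℝ}
    (hF : Measurable F) (h0 : ∀ t, 0 ≤ F t) {C : ℝ} (hC : ∀ t, F t ≤ C) (x : UnitAddCircle) :
    Tendsto (fun r => N fun n =>
      fourierCoeff (fun t => (((Metric.closedBall x r).indicator F t : ℝ) : ℂ)) n *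
        fourierCoeff (fun t => (arcKernel r t : ℂ)) n) (𝓝[>] 0) (𝓝 0) := by
  have hC0 : 0 ≤ C := (h0 x).trans (hC x)
  have hH0 : ∀ r t, 0 ≤ (Metric.closedBall x r).indicator F t :=
    fun r t => indicator_nonneg (fun t _ => h0 t) t
  have hHC : ∀ r t, (Metric.closedBall x r).indicator F t ≤
      (Metric.closedBall x r).indicator (fun _ => C) t :=
    fun r t => indicator_le_indicator (hC t)
  have hsmall : Ioc (0 : ℝ) (1 / 2) ∈ 𝓝[>] (0 : ℝ) := Ioc_mem_nhdsGT (by norm_num)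
  refine hN.small (𝓝[>] 0) _ (2 * C ^ 2 + 1) ?_ fun ε hε => ?_
  · filter_upwards [hsmall] with r ⟨hr, hr2⟩
    have hmem : MemLp (fun t => (((Metric.closedBall x r).indicator F t : ℝ) : ℂ)) 2 𝐦 :=
      memLp_of_nonneg_of_le (hF.indicator Metric.isClosed_closedBall.measurableSet) (hH0 r)
        (fun t => (hHC r t).trans (indicator_le_self' (fun _ _ => hC0) t)) 2
    -- The weight `r⁻¹` balances the squared `L²` norm `O(r)` of the restriction of `F` against the
    -- squared norm `r⁻¹` of `arcKernel r`.
    refine (tsum_norm_fourierCoeff_mul_le hmem (memLp_arcKernel hr 2) (inv_pos.2 hr)).trans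
      (ENNReal.ofReal_le_ofReal (add_le_add ?_ ?_))
    · have h1 : ∫ t, ‖(((Metric.closedBall x r).indicator F t : ℝ) : ℂ)‖ ^ 2 ∂𝐦 ≤
          2 * r * C ^ 2 := by
        refine integral_le_of_le_indicator_closedBall (x := x) hr.le (by linarith)
          (fun t => by positivity) fun t => ?_
        rw [Complex.norm_real, Real.norm_of_nonneg (hH0 r t)]
        by_cases ht : t ∈ Metric.closedBall x r
        · simp only [indicator_of_mem ht]
          have := h0 t
          have := hC t
          gcongr
        · simp [indicator_of_notMem ht]
      calc r⁻¹ * _ ≤ r⁻¹ * (2 * r * C ^ 2) := by gcongr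
        _ = 2 * C ^ 2 := by field_simp
    · rw [integral_sq_arcKernel hr (by linarith), inv_inv, mul_inv_cancel₀ hr.ne']
  · have hlim : Tendsto (fun r : ℝ => 2 * r * C) (𝓝[>] 0) (𝓝 0) := by
      have : Tendsto (fun r : ℝ => 2 * r * C) (𝓝 0) (𝓝 (2 * 0 * C)) :=
        (continuous_const.mul continuous_id |>.mul continuous_const).tendsto 0
      simpa using this.mono_left nhdsWithin_le_nhds
    filter_upwards [hsmall, hlim.eventually (ge_mem_nhds hε)] with r ⟨hr, hr2⟩ hrε n
    rw [norm_mul]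
    refine (mul_le_of_le_one_right (norm_nonneg _)
      (norm_fourierCoeff_arcKernel_le hr (by linarith) n)).trans ?_
    refine (norm_fourierCoeff_le _ n).trans (le_trans ?_ hrε)
    refine integral_le_of_le_indicator_closedBall (x := x) hr.le (by linarith)
      (fun t => norm_nonneg _) fun t => ?_
    rw [Complex.norm_real, Real.norm_of_nonneg (hH0 r t)]
    exact hHC r t

lemma AddCircle.exists_dist_eq_of_le_half (x : UnitAddCircle) {s : ℝ} (hs : 0 ≤ s)
    (hs2 : s ≤ 1 / 2) :
    ∃ z : UnitAddCircle, dist z x = s := by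
  refine ⟨x + (s : ℝ), ?_⟩
  rw [dist_eq_norm, add_sub_cancel_left, (AddCircle.norm_coe_eq_abs_iff 1 one_ne_zero).2
    (by rw [abs_of_nonneg hs, abs_one]; exact hs2), abs_of_nonneg hs]

/-- The closed `r / 2`-neighbourhood of `E`, minus an open arc of length `r` about `x ∈ E`. -/
noncomputable def puncturedThickening (E : NonemptyCompacts UnitAddCircle) {x : UnitAddCircle}
    (hx : x ∈ E) {r : ℝ} (hr : 0 < r) (hr1 : r ≤ 1) : NonemptyCompacts UnitAddCircle where
  carrier := Metric.cthickening (r / 2) (E : Set UnitAddCircle) \ Metric.ball x (r / 2)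
  isCompact' := (Metric.isClosed_cthickening.sdiff Metric.isOpen_ball).isCompact
  nonempty' := by
    obtain ⟨z, hz⟩ := AddCircle.exists_dist_eq_of_le_half x (s := r / 2) (by linarith) (by linarith)
    exact ⟨z, Metric.mem_cthickening_of_dist_le z x _ _ hx hz.le, by simp [hz]⟩

lemma hausdorffSumDist_puncturedThickening_le (E : NonemptyCompacts UnitAddCircle)
    {x : UnitAddCircle} (hx : x ∈ E) {r : ℝ} (hr : 0 < r) (hr1 : r ≤ 1) :
    hausdorffSumDist E (puncturedThickening E hx hr hr1) ≤
      ENNReal.ofReal r + ENNReal.ofReal r := by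
  refine add_le_add (iSup₂_le fun ζ hζ => ?_) (iSup₂_le fun ξ hξ => ?_)
  · exact hζ.1.trans (ENNReal.ofReal_le_ofReal (by linarith))
  · by_cases h : ξ ∈ Metric.ball x (r / 2)
    · obtain ⟨z, hz⟩ :=
        AddCircle.exists_dist_eq_of_le_half x (s := r / 2) (by linarith) (by linarith)
      have hzK : z ∈ (puncturedThickening E hx hr hr1 : Set UnitAddCircle) :=
        ⟨Metric.mem_cthickening_of_dist_le z x _ _ hx hz.le, by simp [hz]⟩
      refine (Metric.infEDist_le_edist_of_mem hzK).trans ?_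
      rw [edist_dist]
      refine ENNReal.ofReal_le_ofReal ?_
      have := dist_triangle_right ξ z x
      have := Metric.mem_ball.1 h
      linarith
    · have hξK : ξ ∈ (puncturedThickening E hx hr hr1 : Set UnitAddCircle) :=
        ⟨Metric.self_subset_cthickening _ hξ, h⟩
      rw [Metric.infEDist_zero_of_mem hξK]
      exact zero_le

/-- The pairs whose set omits a given point are dense: remove a short arc about the point from the
density and average over arcs of half that length. -/
lemma exists_pairDist_lt_notMem (hN : IsAdmissibleNorm N) (p : SupportPair N) {x : UnitAddCircle}
    (hx : x ∈ p.E) {ε : ℝ≥0∞} (hε : 0 < ε) :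
    ∃ q : SupportPair N, x ∉ q.E ∧ pairDist N p q < ε := by
  have hofReal : Tendsto (fun r : ℝ => ENNReal.ofReal r) (𝓝[>] 0) (𝓝 0) := by
    simpa using ENNReal.tendsto_ofReal ((tendsto_id (x := 𝓝 (0 : ℝ))).mono_left nhdsWithin_le_nhds)
  have hlim := (hofReal.add hofReal).add ((tendsto_norm_mul_one_sub_arcKernel hN p).add
    (tendsto_norm_indicator_mul_arcKernel hN p.measurable_density p.density_nonneg p.density_le x))
  simp only [add_zero] at hlim
  obtain ⟨r, hrε, hr, hr1⟩ := ((hlim.eventually (gt_mem_nhds (lt_min hε one_pos))).and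
    (Ioc_mem_nhdsGT one_pos)).exists
  set D := p.density
  set J := Metric.closedBall x r
  have hJ : MeasurableSet J := Metric.isClosed_closedBall.measurableSet
  have hFm : Measurable (Jᶜ.indicator D) := p.measurable_density.indicator hJ.compl
  have hF0 : ∀ t, 0 ≤ Jᶜ.indicator D t :=
    fun t => indicator_nonneg (fun t _ => p.density_nonneg t) t
  have hFC : ∀ t, Jᶜ.indicator D t ≤ 10 :=
    fun t => (indicator_le_self' (fun t _ => p.density_nonneg t) t).trans (p.density_le t)
  have hg : MemLp (arcMean (Jᶜ.indicator D) r) ∞ 𝐦 :=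
    memLp_top_of_bound (aestronglyMeasurable_arcMean hFm hF0 hFC hr) 10
      (Eventually.of_forall fun t => by
        rw [Real.norm_of_nonneg (arcMean_nonneg hF0 hr t)]
        exact arcMean_le hF0 hFC hr hr1 t)
  have hbounds : ∀ᵐ t ∂𝐦, 0 ≤ hg.toLp _ t ∧ hg.toLp _ t ≤ 10 := by
    filter_upwards [hg.coeFn_toLp] with t ht
    rw [ht]
    exact ⟨arcMean_nonneg hF0 hr t, arcMean_le hF0 hFC hr hr1 t⟩
  have hsupp : densitySupport hg.toLp ⊆
      (puncturedThickening p.E hx hr hr1 : Set UnitAddCircle) := by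
    rw [densitySupport_subset_iff (hbounds.mono fun _ ht => ht.1)
      (puncturedThickening p.E hx hr hr1).isCompact.isClosed]
    filter_upwards [hg.coeFn_toLp] with t ht htK
    rw [ht]
    refine arcMean_eq_zero fun y hy => ?_
    by_contra hy0
    have hyJ : y ∈ Jᶜ := mem_of_indicator_ne_zero hy0
    rw [indicator_of_mem hyJ] at hy0
    have hyE : y ∈ (p.E : Set UnitAddCircle) := mem_of_indicator_ne_zero hy0
    refine htK ⟨Metric.mem_cthickening_of_dist_le t y _ _ hyE ?_, fun htx => hyJ ?_⟩
    · rw [dist_comm]; exact hy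
    · have h1 := dist_triangle y t x
      have h2 := Metric.mem_ball.1 htx
      have h3 := Metric.mem_closedBall.1 hy
      exact Metric.mem_closedBall.2 (by linarith)
  have hcoeff : fourierSeq p.f - fourierSeq hg.toLp =
      (fun n => (1 - fourierCoeff (fun x => (arcKernel r x : ℂ)) n) * fourierSeq p.f n) +
      fun n => fourierCoeff (fun t => ((J.indicator D t : ℝ) : ℂ)) n *
        fourierCoeff (fun t => (arcKernel r t : ℂ)) n := by
    funext n
    have h1 : fourierSeq p.f n = fourierCoeff (fun t => ((J.indicator D t : ℝ) : ℂ)) n +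
        fourierCoeff (fun t => ((Jᶜ.indicator D t : ℝ) : ℂ)) n := by
      have hi1 : Integrable (fun t => ((J.indicator D t : ℝ) : ℂ)) 𝐦 :=
        memLp_one_iff_integrable.1 (memLp_of_nonneg_of_le (C := 10)
          (p.measurable_density.indicator hJ)
          (fun t => indicator_nonneg (fun t _ => p.density_nonneg t) t)
          (fun t => (indicator_le_self' (fun t _ => p.density_nonneg t) t).trans
            (p.density_le t)) 1)
      have hi2 : Integrable (fun t => ((Jᶜ.indicator D t : ℝ) : ℂ)) 𝐦 :=
        memLp_one_iff_integrable.1 (memLp_of_nonneg_of_le hFm hF0 hFC 1)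
      rw [fourierSeq_eq_of_ae p.density_ae_eq, ← Pi.add_apply (fourierCoeff _),
        ← fourierCoeff.add hi1 hi2]
      congr 1
      funext t
      rw [Pi.add_apply, ← Complex.ofReal_add, indicator_self_add_compl_apply]
    rw [Pi.sub_apply, Pi.add_apply, fourierSeq_eq_of_ae hg.coeFn_toLp,
      fourierCoeff_arcMean hFm hF0 hFC hr, h1]
    ring
  -- The norm of the difference is bounded by the last two terms of `hlim`.
  have hNle : N (fourierSeq p.f - fourierSeq hg.toLp) ≤ _ := hcoeff ▸ hN.add_le _ _
  have hX : N (fourierSeq hg.toLp) < ∞ := by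
    have h1 := hN.add_le (fourierSeq hg.toLp - fourierSeq p.f) (fourierSeq p.f)
    rw [sub_add_cancel, hN.sub_comm] at h1
    refine h1.trans_lt (ENNReal.add_lt_top.2 ⟨hNle.trans_lt ?_, p.mem_X⟩)
    exact (le_add_self.trans_lt hrε).trans_le ((min_le_right _ _).trans le_top)
  refine ⟨⟨hg.toLp, puncturedThickening p.E hx hr hr1, hsupp, hbounds, hX⟩, fun h => ?_, ?_⟩
  · exact h.2 (Metric.mem_ball_self (by linarith))
  · rw [pairDist_eq]
    exact (add_le_add (hausdorffSumDist_puncturedThickening_le _ hx hr hr1) hNle).trans_lt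
      (hrε.trans_le (min_le_left _ _))

lemma SupportPair.isOpen_notMem (hN : IsAdmissibleNorm N) (x : UnitAddCircle) :
    letI := SupportPair.metricSpace hN
    IsOpen {p : SupportPair N | x ∉ p.E} := by
  let _ := SupportPair.metricSpace hN
  rw [EMetric.isOpen_iff]
  intro p hp
  refine ⟨Metric.infEDist x (p.E : Set UnitAddCircle), ?_, fun q hq hxq => ?_⟩
  · exact pos_iff_ne_zero.2 fun h => hp
      ((Metric.mem_iff_infEDist_zero_of_closed p.E.isCompact.isClosed).2 h)
  · have h1 : hausdorffSumDist q.E p.E + N (fourierSeq q.f - fourierSeq p.f) <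
        Metric.infEDist x (p.E : Set UnitAddCircle) := by
      rw [← pairDist_eq]; exact hq
    have h2 : Metric.infEDist x (p.E : Set UnitAddCircle) ≤ hausdorffSumDist q.E p.E := by
      refine le_add_left ?_
      exact le_iSup₂ (f := fun ξ (_ : ξ ∈ (q.E : Set UnitAddCircle)) =>
        Metric.infEDist ξ (p.E : Set UnitAddCircle)) x hxq
    exact (h2.trans le_self_add).not_gt h1

lemma SupportPair.dense_notMem (hN : IsAdmissibleNorm N) (x : UnitAddCircle) :
    letI := SupportPair.metricSpace hN
    Dense {p : SupportPair N | x ∉ p.E} := by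
  let _ := SupportPair.metricSpace hN
  intro p
  by_cases hx : x ∈ p.E
  · rw [EMetric.mem_closure_iff]
    intro ε hε
    exact exists_pairDist_lt_notMem hN p hx hε
  · exact subset_closure hx

lemma SupportPair.empty_interior_mem_residual (hN : IsAdmissibleNorm N) :
    letI := SupportPair.metricSpace hN
    {p : SupportPair N | interior (p.E : Set UnitAddCircle) = ∅} ∈
      residual (SupportPair N) := by
  let _ := SupportPair.metricSpace hN
  obtain ⟨s, hs, hsd⟩ := exists_countable_dense UnitAddCircle
  have h : ∀ x ∈ s, {p : SupportPair N | x ∉ p.E} ∈ residual (SupportPair N) := fun x _ =>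
    residual_of_dense_open (SupportPair.isOpen_notMem hN x) (SupportPair.dense_notMem hN x)
  filter_upwards [(countable_bInter_mem hs).2 h] with p hp
  by_contra hne
  obtain ⟨x, hxE, hxs⟩ := hsd.inter_open_nonempty _ isOpen_interior
    (nonempty_iff_ne_empty.2 hne)
  exact mem_iInter₂.1 hp x hxs (interior_subset hxE)

end Approximation

/-! ### Completeness and genericity for the two families of spaces -/

theorem mainTheorem1 (normX : (ℤ → ℂ) → ℝ≥0∞)
    (hX : (∃ w : ℕ → ℝ, (∀ n, 0 < w n) ∧ Antitone w ∧ Tendsto w atTop (𝓝 0) ∧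
            normX = weightedL1Norm w) ∨
          (∃ Φ : ℝ → ℝ, IsYoungFunction Φ ∧ MonotoneOn (fun t => Φ t / t) (Ioi 0) ∧
            Tendsto (fun t => Φ t / t) (𝓝[>] 0) (𝓝 0) ∧ normX = orliczNorm Φ)) :
    ∃ _ : MetricSpace (SupportPair normX),
      (∀ p q : SupportPair normX, edist p q = pairDist normX p q) ∧
      CompleteSpace (SupportPair normX) ∧
      {p : SupportPair normX | interior (p.E : Set UnitAddCircle) = ∅} ∈
        residual (SupportPair normX) := by
  have hN : IsAdmissibleNorm normX := by
    rcases hX with ⟨w, hw, hanti, hlim, rfl⟩ | ⟨Φ, hΦ, hm, hlim, rfl⟩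
    · exact isAdmissibleNorm_weightedL1Norm hw hanti hlim
    · exact isAdmissibleNorm_orliczNorm hΦ hm hlim
  exact ⟨SupportPair.metricSpace hN, fun _ _ => rfl, SupportPair.completeSpace hN,
    SupportPair.empty_interior_mem_residual hN⟩
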